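/- Let $D=(V,A)$ be a finite directed graph (parallel arcs and loops are allowed), and let $V_1,V_2$ be a partition of $V$ such that no arc of $D$ goes from $V_2$ to $V_1$. Let $\delta(V_1,V_2)\subseteq A$ denote the set of arcs from $V_1$ to $V_2$. A $(V_1,V_2)$-bibranching is an arc set $F\subseteq A$ such that for every $v\in V_1$ there is a directed path in $F$ from $v$ to some vertex of $V_2$, and for every $v\in V_2$ there is a directed path in $F$ from some vertex of $V_1$ to $v$. Suppose that $A$ can be partitioned into $k$ $(V_1,V_2)$-bibranchings. Then $A$ can be partitioned into $k$ pairwise disjoint $(V_1,V_2)$-bibranchings $F_1,\dots,F_k$ such that, writing $N_i=F_i\cap\delta(V_1,V_2)$ and $B_i=F_i\setminus N_i$, for all $i,j\in\{1,\dots,k\}$ we have $$\bigl||F_i|-|F_j|\bigr|\le 2,\qquad \bigl||N_i|-|N_j|\bigr|\le 1,\qquad \bigl||B_i|-|B_j|\bigr|\le 2.$$ -/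

import Mathlib

/-- A directed multigraph with vertex set `V` and arc set `A`; parallel arcs and loops are allowed. -/
structure MultiDigraph (V A : Type*) where
  tail : A → V
  head : A → V

namespace MultiDigraph

/-- `V₁, V₂` partition the vertex set and no arc goes from `V₂` to `V₁`
(so that `D` is the partitionable digraph `(V₁, V₂; A)`). -/
structure IsPartitionable {V A : Type*} (D : MultiDigraph V A) (V₁ V₂ : Set V) : Prop where
  disjoint : Disjoint V₁ V₂
  union_eq : V₁ ∪ V₂ = Set.univ
  no_back_arc : ∀ a : A, ¬ (D.tail a ∈ V₂ ∧ D.head a ∈ V₁)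

/-- The set `δ(V₁, V₂)` of arcs from `V₁` to `V₂`. -/
def delta {V A : Type*} (D : MultiDigraph V A) (V₁ V₂ : Set V) : Set A :=
  {a | D.tail a ∈ V₁ ∧ D.head a ∈ V₂}

/-- There is a directed path from `u` to `v` all of whose arcs belong to `F`. -/
def Reaches {V A : Type*} (D : MultiDigraph V A) (F : Set A) (u v : V) : Prop :=
  Relation.ReflTransGen (fun x y => ∃ a ∈ F, D.tail a = x ∧ D.head a = y) u v

/-- `F` is a `(V₁, V₂)`-bibranching: inside `F`, every vertex of `V₁` has a path to `V₂`, and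
every vertex of `V₂` has a path from `V₁`. -/
structure IsBibranching {V A : Type*} (D : MultiDigraph V A) (V₁ V₂ : Set V) (F : Set A) :
    Prop where
  exists_to : ∀ v ∈ V₁, ∃ w ∈ V₂, D.Reaches F v w
  exists_from : ∀ v ∈ V₂, ∃ u ∈ V₁, D.Reaches F u v

/-- The sets `F i`, `i < k`, are pairwise disjoint `(V₁, V₂)`-bibranchings whose union is the
whole arc set. -/
structure IsBibranchingPartition {V A : Type*} (D : MultiDigraph V A) (V₁ V₂ : Set V) {k : ℕ}
    (F : Fin k → Set A) : Prop where
  bibranching : ∀ i, D.IsBibranching V₁ V₂ (F i)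
  disjoint : ∀ i j, i ≠ j → Disjoint (F i) (F j)
  union_eq : ⋃ i, F i = Set.univ

end MultiDigraph

open Finset

/-! It suffices to rebalance two disjoint bibranchings at a time: a partition minimising
lexicographically the sums of squares of `|N_i|`, `|B_i|` and `|F_i|` then satisfies all the bounds
(`exists_pairwise_rebalanced`).

For two of them, pool the arcs and 2-colour the crossing arcs. Once these are coloured, the two
sides are independent, one being the other with arcs reversed. On a side, each colour class reaches
some heads, and Edmonds' theorem for these two root sets (`exists_disjoint_branchings`) yields
disjoint completions as soon as every minimal set that no inner arc enters meets heads of both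
colours. A suitable pairing of the crossing arcs guarantees this for every colouring that splits the
pairs, and also nearly balances the numbers of arcs and of distinct heads of each colour
(`exists_pairing`). Two pairings, one per side, form a bipartite graph, so one colouring splits both
(`exists_common_alternates`).

A completion has exactly one arc per vertex that is not yet a root, so its size is governed by the
head counts. The unused non-crossing arcs are free, and distributing them balances the sizes
(`exists_balanced_size`). -/

/-- Every nonempty vertex set avoiding `R` is entered by an arc of `F`. -/
def EntersAvoiding {V A : Type*} (t h : A → V) (F : Finset A) (R : Finset V) : Prop :=
  ∀ X : Finset V, X.Nonempty → Disjoint X R → ∃ a ∈ F, t a ∉ X ∧ h a ∈ X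

/-! ### Edmonds' disjoint branchings for two root sets -/

section Branchings

variable {V A : Type*} [DecidableEq V] [DecidableEq A] (t h : A → V)

/-- The arcs of `C` entering `X`. -/
def inCut (C : Finset A) (X : Finset V) : Finset A := {a ∈ C | t a ∉ X ∧ h a ∈ X}

variable {t h}

theorem mem_inCut {C : Finset A} {X : Finset V} {a : A} :
    a ∈ inCut t h C X ↔ a ∈ C ∧ t a ∉ X ∧ h a ∈ X := by
  simp [inCut]

theorem EntersAvoiding.mono {F G : Finset A} {R : Finset V} (hF : EntersAvoiding t h F R)
    (hFG : F ⊆ G) : EntersAvoiding t h G R := by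
  intro X hX hXR
  obtain ⟨a, ha, h1⟩ := hF X hX hXR
  exact ⟨a, hFG ha, h1⟩

theorem EntersAvoiding.insert_arc {S : Finset A} {R : Finset V} {a : A} (ha : t a ∈ R)
    (hS : EntersAvoiding t h S (insert (h a) R)) : EntersAvoiding t h (insert a S) R := by
  intro X hX hXR
  by_cases hv : h a ∈ X
  · exact ⟨a, mem_insert_self _ _, fun h1 => disjoint_left.1 hXR h1 ha, hv⟩
  · obtain ⟨c, hc, h1⟩ := hS X hX (by
      rw [disjoint_insert_right]; exact ⟨hv, hXR⟩)
    exact ⟨c, mem_insert_of_mem hc, h1⟩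

theorem card_inCut_submodular (C : Finset A) (X Y : Finset V) :
    #(inCut t h C (X ∩ Y)) + #(inCut t h C (X ∪ Y)) ≤ #(inCut t h C X) + #(inCut t h C Y) := by
  rw [← card_union_add_card_inter, ← card_union_add_card_inter (inCut t h C X)]
  apply Nat.add_le_add <;> apply card_le_card <;> intro a <;>
    simp only [mem_union, mem_inter, mem_inCut] <;> tauto

variable [Fintype V]

theorem EntersAvoiding.card_compl_le {S : Finset A} {R : Finset V}
    (hS : EntersAvoiding t h S R) : #Rᶜ ≤ #S := by
  refine (card_le_card (t := S.image h) ?_).trans card_image_le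
  intro v hv
  obtain ⟨a, ha, -, h2⟩ := hS {v} (singleton_nonempty v) (by simpa using hv)
  exact mem_image.2 ⟨a, ha, mem_singleton.1 h2⟩

/-- Greedy growth: an arc entering `Rᶜ` lets its head join `R`, at a cost of one arc per vertex. The
exact count later turns numbers of heads into numbers of arcs. -/
theorem EntersAvoiding.exists_minimal {C : Finset A} {R : Finset V}
    (hC : EntersAvoiding t h C R) : ∃ S ⊆ C, EntersAvoiding t h S R ∧ #S = #Rᶜ := by
  suffices H : ∃ S ⊆ C, EntersAvoiding t h S R ∧ #S ≤ #Rᶜ by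
    obtain ⟨S, h1, h2, h3⟩ := H
    exact ⟨S, h1, h2, le_antisymm h3 h2.card_compl_le⟩
  induction hn : #Rᶜ generalizing R with
  | zero =>
    refine ⟨∅, empty_subset _, ?_, by simp⟩
    intro X ⟨x, hx⟩ hXR
    rw [card_eq_zero, compl_eq_empty_iff] at hn
    exact absurd (hn ▸ mem_univ x) (disjoint_left.1 hXR hx)
  | succ n ih =>
    obtain ⟨a, haC, ht, hh⟩ := hC Rᶜ (card_pos.1 (by omega)) disjoint_compl_left
    simp only [mem_compl, not_not] at ht hh
    have hcard : #(insert (h a) R)ᶜ = n := by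
      rw [card_compl] at hn ⊢
      rw [card_insert_of_notMem hh]; omega
    obtain ⟨S, h1, h2, h3⟩ := ih (R := insert (h a) R)
      (fun X hX hXR => hC X hX (disjoint_of_subset_right (subset_insert _ _) hXR)) hcard
    exact ⟨insert a S, insert_subset haC h1, h2.insert_arc ht,
      (card_insert_le _ _).trans (by omega)⟩

/-- The growing step in Lovász's proof of Edmonds' disjoint branchings theorem. -/
theorem exists_arc_growing {C : Finset A} {R R' : Finset V} (hR : Rᶜ.Nonempty)
    (hC : ∀ X : Finset V, X.Nonempty →
      (if Disjoint X R then 1 else 0) + (if Disjoint X R' then 1 else 0) ≤ #(inCut t h C X)) :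
    ∃ a ∈ C, t a ∈ R ∧ h a ∉ R ∧
      ∀ Y, Disjoint Y R' → ¬ Disjoint Y R → #(inCut t h C Y) = 1 → t a ∉ Y → h a ∉ Y := by
  -- The arc to be removed must not enter a tight set, one avoiding `R'`, meeting `R` and entered
  -- only once. Tight sets inside `R` are harmless, since the head lies outside `R`.
  let 𝒯 : Finset (Finset V) :=
    {X | Disjoint X R' ∧ ¬ Disjoint X R ∧ #(inCut t h C X) = 1 ∧ ¬ X ⊆ R}
  rcases 𝒯.eq_empty_or_nonempty with h0 | h0
  · have h1 := hC Rᶜ hR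
    rw [if_pos disjoint_compl_left] at h1
    obtain ⟨a, ha⟩ := card_pos.1 (show 0 < #(inCut t h C Rᶜ) by omega)
    simp only [mem_inCut, mem_compl, not_not] at ha
    refine ⟨a, ha.1, ha.2.1, ha.2.2, fun Y h1 h2 h3 _ h5 => ?_⟩
    have : Y ∈ 𝒯 := by
      simp only [𝒯, mem_filter_univ]
      exact ⟨h1, h2, h3, fun h6 => ha.2.2 (h6 h5)⟩
    simp [h0] at this
  · obtain ⟨X, hX⟩ := 𝒯.exists_minimal h0
    have hX1 := hX.1
    simp only [𝒯, mem_filter_univ] at hX1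
    obtain ⟨hXR', hXR, hX1, hXs⟩ := hX1
    -- `X \ R` avoids both root sets, so it is entered at least twice, while `X` is entered once:
    -- some arc goes from `X ∩ R` to `X \ R`. If it entered a tight `Y`, then `X ∩ Y` would be a
    -- smaller member of `𝒯` by submodularity.
    have hcut : #(inCut t h C X) < #(inCut t h C (X \ R)) := by
      have := hC (X \ R) (sdiff_nonempty.2 hXs)
      rw [if_pos sdiff_disjoint, if_pos (disjoint_of_subset_left sdiff_subset hXR')] at this
      omega
    obtain ⟨a, ha, ha'⟩ := exists_mem_notMem_of_card_lt_card hcut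
    simp only [mem_inCut, mem_sdiff] at ha ha'
    refine ⟨a, ha.1, by tauto, by tauto, fun Y h1 h2 h3 h4 h5 => ?_⟩
    have hne : (X ∩ Y).Nonempty := ⟨h a, by simp [ha, h5]⟩
    have hsub := card_inCut_submodular (t := t) (h := h) C X Y
    have e1 := hC (X ∩ Y) hne
    have e2 := hC (X ∪ Y) (hne.mono (inter_subset_left.trans subset_union_left))
    have d1 : Disjoint (X ∩ Y) R' := disjoint_of_subset_left inter_subset_left hXR'
    rw [if_pos d1] at e1
    rw [if_pos (disjoint_union_left.2 ⟨hXR', h1⟩)] at e2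
    have d2 : ¬ Disjoint (X ∩ Y) R := by
      intro hd
      rw [if_pos hd] at e1
      omega
    have hmem : X ∩ Y ∈ 𝒯 := by
      simp only [𝒯, mem_filter_univ]
      exact ⟨d1, d2, by omega, fun h6 => ha.2.2.2 (h6 (by simp [ha, h5]))⟩
    have hle : X ≤ X ∩ Y := hX.2 hmem inter_subset_left
    have : t a ∈ X := by tauto
    exact h4 (mem_inter.1 (hle this)).2

/-- Edmonds' disjoint branchings theorem for two root sets. -/
theorem exists_disjoint_branchings {C : Finset A} {R R' : Finset V}
    (hC : ∀ X : Finset V, X.Nonempty →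
      (if Disjoint X R then 1 else 0) + (if Disjoint X R' then 1 else 0) ≤ #(inCut t h C X)) :
    ∃ S ⊆ C, ∃ S' ⊆ C, Disjoint S S' ∧ EntersAvoiding t h S R ∧ EntersAvoiding t h S' R' ∧
      #S = #Rᶜ ∧ #S' = #R'ᶜ := by
  suffices H : ∃ S ⊆ C, EntersAvoiding t h S R ∧ EntersAvoiding t h (C \ S) R' ∧ #S ≤ #Rᶜ by
    obtain ⟨S, h1, h2, h3, h4⟩ := H
    obtain ⟨S', h5, h6, h7⟩ := h3.exists_minimal
    exact ⟨S, h1, S', h5.trans sdiff_subset, disjoint_of_subset_right h5 disjoint_sdiff, h2, h6,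
      le_antisymm h4 h2.card_compl_le, h7⟩
  induction hn : #Rᶜ generalizing R C with
  | zero =>
    rw [card_eq_zero, compl_eq_empty_iff] at hn
    refine ⟨∅, empty_subset _, ?_, ?_, by simp⟩
    · intro X ⟨x, hx⟩ hXR
      exact absurd (hn ▸ mem_univ x) (disjoint_left.1 hXR hx)
    · intro X hX hXR
      have := hC X hX
      rw [if_pos hXR] at this
      obtain ⟨a, ha⟩ := card_pos.1 (show 0 < #(inCut t h C X) by omega)
      rw [mem_inCut] at ha
      exact ⟨a, by simpa using ha.1, ha.2⟩
  | succ n ih =>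
    obtain ⟨a, haC, hta, hha, hY⟩ := exists_arc_growing (card_pos.1 (by omega)) hC
    have hcard : #(insert (h a) R)ᶜ = n := by
      rw [card_compl] at hn ⊢
      rw [card_insert_of_notMem hha]; omega
    obtain ⟨S, h1, h2, h3, h4⟩ := ih (C := C.erase a) (R := insert (h a) R) (by
      intro X hX
      have h0 := hC X hX
      have hd : Disjoint X (insert (h a) R) ↔ h a ∉ X ∧ Disjoint X R := disjoint_insert_right
      by_cases hent : t a ∉ X ∧ h a ∈ X
      · have hcut : inCut t h (C.erase a) X = (inCut t h C X).erase a := by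
          ext c; simp only [mem_inCut, mem_erase]; tauto
        have hmem : a ∈ inCut t h C X := mem_inCut.2 ⟨haC, hent⟩
        have hpos := card_pos.2 ⟨a, hmem⟩
        rw [hcut, card_erase_of_mem hmem, if_neg (by tauto)]
        by_cases d1 : Disjoint X R
        · rw [if_pos d1] at h0; omega
        · by_cases d2 : Disjoint X R'
          · rw [if_pos d2]
            have : #(inCut t h C X) ≠ 1 := fun h5 => hY X d2 d1 h5 hent.1 hent.2
            omega
          · rw [if_neg d2]; omega
      · have hcut : inCut t h (C.erase a) X = inCut t h C X := by
          ext c; simp only [mem_inCut, mem_erase]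
          constructor
          · tauto
          · rintro ⟨h5, h6⟩
            exact ⟨⟨fun h7 => hent (h7 ▸ h6), h5⟩, h6⟩
        rw [hcut]
        refine le_trans (Nat.add_le_add_right ?_ _) h0
        split_ifs with h5 h6
        · exact le_rfl
        · exact absurd (hd.1 h5).2 h6
        · exact Nat.zero_le _
        · exact le_rfl) hcard
    refine ⟨insert a S, insert_subset haC (h1.trans (erase_subset _ _)), h2.insert_arc hta,
      h3.mono ?_, (card_insert_le _ _).trans (by omega)⟩
    intro c
    simp only [mem_sdiff, mem_erase, mem_insert]
    tauto

end Branchings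

/-! ### Colourings that split the pairs of involutions -/

section Involutions

variable {α : Type*}

/-- `ε` takes different values at the two elements of each pair exchanged by `σ`. -/
def Alternates (σ : α → α) (ε : α → Bool) : Prop := ∀ e, σ e ≠ e → ε (σ e) ≠ ε e

theorem exists_alternates [Finite α] {σ : α → α} (hσ : σ.Involutive) :
    ∃ ε, Alternates σ ε := by
  classical
  obtain ⟨n, ⟨f⟩⟩ := Finite.exists_equiv_fin α
  refine ⟨fun e => decide (f e < f (σ e)), fun e he => ?_⟩
  have : f (σ e) ≠ f e := fun h => he (f.injective h)
  simp only [hσ e, ne_eq, decide_eq_decide]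
  omega

/-- The union of two matchings consists of paths and even cycles, hence is bipartite. The induction
deletes one pair of `τ` and contracts the path through it. -/
theorem exists_common_alternates [Finite α] {σ τ : α → α} (hσ : σ.Involutive)
    (hτ : τ.Involutive) : ∃ ε, Alternates σ ε ∧ Alternates τ ε := by
  classical
  have := Fintype.ofFinite α
  induction hn : #{e | τ e ≠ e} using Nat.strong_induction_on generalizing σ τ with
  | _ n ih =>
  by_cases hid : ∀ e, τ e = e
  · obtain ⟨ε, h⟩ := exists_alternates hσ
    exact ⟨ε, h, fun e he => absurd (hid e) he⟩
  push Not at hid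
  obtain ⟨a, ha⟩ := hid
  obtain ⟨b, hb⟩ : ∃ b, b = τ a := ⟨_, rfl⟩
  have hba : τ b = a := by rw [hb, hτ]
  let τ' : α → α := fun x => if x = a ∨ x = b then x else τ x
  have hτ' : τ'.Involutive := by
    intro x
    have := hτ x
    simp only [τ']
    grind
  have hlt : #{e | τ' e ≠ e} < n := by
    rw [← hn]
    refine card_lt_card ⟨fun x => ?_, fun h => ?_⟩
    · simp only [mem_filter_univ, τ']
      grind
    · have := h (show a ∈ ({e | τ e ≠ e} : Finset α) by simpa using ha)
      simp [τ'] at this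
  -- The path `σ a – a – b – σ b` is contracted to a pair `σ a – σ b`; if one of these ends is
  -- missing, the other becomes a fixed point.
  let σ' : α → α := fun x =>
    if x = a ∨ x = b then x
    else if σ x = a then (if σ b = b then x else σ b)
    else if σ x = b then (if σ a = a then x else σ a)
    else σ x
  have hσa := hσ a
  have hσb := hσ b
  have hσ' : σ'.Involutive := by
    intro x
    have := hσ x
    simp only [σ']
    grind
  obtain ⟨ε, h1, h2⟩ := ih _ hlt hσ' hτ' rfl
  -- `ε` already separates `σ a` from `σ b` when both exist, so opposite colours for `a` and `b` can
  -- be chosen compatibly.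
  have key : ∃ p : Bool, (σ a ≠ a → σ a ≠ b → ε (σ a) ≠ p) ∧
      (σ b ≠ b → σ b ≠ a → ε (σ b) ≠ !p) := by
    have h3 := h1 (σ a)
    simp only [σ'] at h3
    by_cases h4 : σ a = a
    · exact ⟨ε (σ b), by simp [h4], by simp⟩
    · refine ⟨!ε (σ a), by simp, fun h5 h6 => ?_⟩
      grind
  obtain ⟨p, hp1, hp2⟩ := key
  refine ⟨fun x => if x = a then p else if x = b then !p else ε x, ?_, ?_⟩
  · intro x hx
    have h3 := h1 x
    have := hσ x
    simp only [σ'] at h3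
    grind
  · intro x hx
    have h3 := h2 x
    have := hτ x
    simp only [τ'] at h3
    grind

/-- An involution can be extended by pairs with equal keys until no two fixed points in `N`
have the same key. -/
theorem exists_involution_extension [Finite α] {β : Type*} (N : Finset α) (f : α → β) {σ : α → α}
    (hσ : σ.Involutive) : ∃ σ' : α → α, σ'.Involutive ∧ (∀ e, σ e ≠ e → σ' e = σ e) ∧
      (∀ e, σ' e ≠ σ e → e ∈ N ∧ f (σ' e) = f e) ∧
      ∀ e ∈ N, ∀ e' ∈ N, σ' e = e → σ' e' = e' → f e = f e' → e = e' := by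
  classical
  have := Fintype.ofFinite α
  induction hn : #{e | σ e = e} using Nat.strong_induction_on generalizing σ with
  | _ n ih =>
  by_cases H : ∀ e ∈ N, ∀ e' ∈ N, σ e = e → σ e' = e' → f e = f e' → e = e'
  · exact ⟨σ, hσ, fun _ _ => rfl, fun e he => absurd rfl he, H⟩
  push Not at H
  obtain ⟨a, haN, b, hbN, ha, hb, hf, hab⟩ := H
  let σ₁ : α → α := fun x => if x = a then b else if x = b then a else σ x
  have hσ₁ : σ₁.Involutive := by
    intro x
    have := hσ x
    simp only [σ₁]
    grind
  have hlt : #{e | σ₁ e = e} < n := by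
    rw [← hn]
    refine card_lt_card ⟨fun x => ?_, fun h => ?_⟩
    · simp only [mem_filter_univ, σ₁]
      grind
    · have := h (show a ∈ ({e | σ e = e} : Finset α) by simpa using ha)
      simp only [mem_filter_univ, σ₁, if_pos] at this
      exact hab this.symm
  obtain ⟨σ', h1, h2, h3, h4⟩ := ih _ hlt hσ₁ rfl
  refine ⟨σ', h1, fun e he => ?_, fun e he => ?_, h4⟩
  · have := h2 e
    simp only [σ₁] at this
    grind
  · have := h2 e
    have := h3 e
    simp only [σ₁] at *
    grind

/-- `σ` injects the non-fixed elements of one colour into the other colour, and at most one element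
is left unpaired. -/
theorem Alternates.abs_card_sub_card_le_one [DecidableEq α] {T : Finset α} {σ : α → α}
    {ε : α → Bool} (hσ : σ.Involutive) (hε : Alternates σ ε) (hT : ∀ e ∈ T, σ e ∈ T)
    (hfix : ∀ e ∈ T, ∀ e' ∈ T, σ e = e → σ e' = e' → e = e') :
    |(#{e ∈ T | ε e = true} : ℤ) - #{e ∈ T | ε e = false}| ≤ 1 := by
  have hle : ∀ b, #{e ∈ T | ε e = b} ≤ #{e ∈ T | ε e = !b} + 1 := by
    intro b
    have h1 : #{e ∈ {e ∈ T | ε e = b} | σ e ≠ e} ≤ #{e ∈ T | ε e = !b} := by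
      apply card_le_card_of_injOn σ _ hσ.injective.injOn
      intro e he
      simp only [coe_filter, mem_filter, Set.mem_ofPred_eq] at he ⊢
      refine ⟨hT e he.1.1, ?_⟩
      have := hε e he.2
      rw [he.1.2] at this
      revert this
      cases ε (σ e) <;> cases b <;> simp
    have h2 : #{e ∈ {e ∈ T | ε e = b} | ¬ σ e ≠ e} ≤ 1 := by
      rw [card_le_one]
      intro e he e' he'
      simp only [mem_filter, not_not] at he he'
      exact hfix e he.1.1 e' he'.1.1 he.2 he'.2
    have := card_filter_add_card_filter_not (s := {e ∈ T | ε e = b}) (fun e => σ e ≠ e)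
    omega
  have h1 := hle true
  have h2 := hle false
  simp only [Bool.not_true, Bool.not_false] at h1 h2
  rw [abs_le]
  omega

end Involutions

/-! ### Pairing the crossing arcs on one side -/

section Pairing

variable {V A : Type*} [DecidableEq V] [DecidableEq A]

/-- The elements of `N` whose value under `h` is shared with no other element of `N`. -/
def singles (h : A → V) (N : Finset A) : Finset A := {e ∈ N | ∀ e' ∈ N, h e' = h e → e' = e}

theorem mem_singles {h : A → V} {N : Finset A} {e : A} :
    e ∈ singles h N ↔ e ∈ N ∧ ∀ e' ∈ N, h e' = h e → e' = e := by simp [singles]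

/-- If every value shared by two elements is taken in both colours, then the numbers of values
in the two colours differ as do the numbers of singles. -/
theorem card_image_colour {h : A → V} {N : Finset A} {ε : A → Bool}
    (hv : ∀ e ∈ N, e ∉ singles h N → ∀ b, ∃ e' ∈ N, ε e' = b ∧ h e' = h e) (b : Bool) :
    #({e ∈ N | ε e = b}.image h) =
      #((N \ singles h N).image h) + #{e ∈ singles h N | ε e = b} := by
  have h1 : {e ∈ N | ε e = b}.image h =
      (N \ singles h N).image h ∪ {e ∈ singles h N | ε e = b}.image h := by
    ext v
    simp only [mem_image, mem_union, mem_filter, mem_sdiff]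
    constructor
    · rintro ⟨e, ⟨he, hb⟩, rfl⟩
      by_cases hs : e ∈ singles h N
      · exact Or.inr ⟨e, ⟨hs, hb⟩, rfl⟩
      · exact Or.inl ⟨e, ⟨he, hs⟩, rfl⟩
    · rintro (⟨e, ⟨he, hs⟩, rfl⟩ | ⟨e, ⟨he, hb⟩, rfl⟩)
      · obtain ⟨e', h1, h2, h3⟩ := hv e he hs b
        exact ⟨e', ⟨h1, h2⟩, h3⟩
      · exact ⟨e, ⟨(mem_singles.1 he).1, hb⟩, rfl⟩
  rw [h1, card_union_of_disjoint, card_image_of_injOn (s := {e ∈ singles h N | ε e = b})]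
  · intro e he e' he' hee
    simp only [coe_filter, Set.mem_ofPred_eq, mem_singles] at he he'
    exact he'.1.2 e he.1.1 hee
  · rw [disjoint_left]
    intro v hv1 hv2
    obtain ⟨e, he, rfl⟩ := mem_image.1 hv1
    obtain ⟨e', he', hee⟩ := mem_image.1 hv2
    rw [mem_filter] at he'
    rw [mem_sdiff] at he
    have := (mem_singles.1 he'.1).2 e he.1 hee.symm
    exact he.2 (this ▸ he'.1)

/-- Arcs are paired greedily with ever coarser keys. A head shared by several arcs gets both
colours, so `ρ` counts only singles and `n - ρ` only the other arcs; the pairing balances each of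
these two classes to within one. -/
theorem exists_pairing [Finite A] (h : A → V) (N : Finset A) (𝒦 : Finset (Finset V))
    (hdisj : ∀ K ∈ 𝒦, ∀ K' ∈ 𝒦, ∀ v ∈ K, v ∈ K' → K = K')
    (htwo : ∀ K ∈ 𝒦, ∃ e ∈ N, ∃ e' ∈ N, e ≠ e' ∧ h e ∈ K ∧ h e' ∈ K) :
    ∃ σ : A → A, σ.Involutive ∧ ∀ ε, Alternates σ ε →
      (∀ K ∈ 𝒦, ∀ b, ∃ e ∈ N, ε e = b ∧ h e ∈ K) ∧
      ∃ n ρ : ℤ, n = #{e ∈ N | ε e = true} - #{e ∈ N | ε e = false} ∧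
        ρ = #({e ∈ N | ε e = true}.image h) - #({e ∈ N | ε e = false}.image h) ∧
        |n| ≤ 1 ∧ |ρ| ≤ 1 ∧ |n - ρ| ≤ 1 := by
  let s : A → Bool := fun e => decide (e ∈ singles h N)
  let g : A → Finset (Finset V) := fun e => {K ∈ 𝒦 | h e ∈ K}
  have hid : Function.Involutive (id : A → A) := fun _ => rfl
  -- Keys in turn: same head; same members of `𝒦` and same single status; same single status;
  -- anything. Each involution extends the previous one, so a colouring alternating on the last
  -- alternates on all.
  obtain ⟨σ₁, hi₁, -, hk₁, hf₁⟩ := exists_involution_extension N h hid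
  obtain ⟨σ₂, hi₂, he₂, hk₂, hf₂⟩ := exists_involution_extension N (fun e => (g e, s e)) hi₁
  obtain ⟨σ₃, hi₃, he₃, hk₃, hf₃⟩ := exists_involution_extension N s hi₂
  obtain ⟨σ₄, hi₄, he₄, hk₄, hf₄⟩ := exists_involution_extension N (fun _ => ()) hi₃
  simp only [id] at hk₁
  have hN : ∀ {σ : A → A}, σ.Involutive → (∀ e, σ e ≠ e → e ∈ N) → ∀ e ∈ N, σ e ∈ N := by
    intro σ hi hs e he
    by_cases h1 : σ e = e
    · rwa [h1]
    · exact hs _ (fun h2 => h1 (by rw [hi] at h2; exact h2.symm))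
  have hs₁ : ∀ e, σ₁ e ≠ e → e ∈ N := fun e he => (hk₁ e he).1
  have hs₂ : ∀ e, σ₂ e ≠ e → e ∈ N := fun e he => by
    by_cases h1 : σ₂ e = σ₁ e
    · exact hs₁ e (h1 ▸ he)
    · exact (hk₂ e h1).1
  have hs₃ : ∀ e, σ₃ e ≠ e → e ∈ N := fun e he => by
    by_cases h1 : σ₃ e = σ₂ e
    · exact hs₂ e (h1 ▸ he)
    · exact (hk₃ e h1).1
  have hs₄ : ∀ e, σ₄ e ≠ e → e ∈ N := fun e he => by
    by_cases h1 : σ₄ e = σ₃ e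
    · exact hs₃ e (h1 ▸ he)
    · exact (hk₄ e h1).1
  have hns₁ : ∀ e, σ₁ e ≠ e → e ∉ singles h N := fun e he h1 =>
    he ((mem_singles.1 h1).2 _ (hN hi₁ hs₁ e (hs₁ e he)) (hk₁ e he).2)
  have hS : ∀ e, σ₃ e ∈ singles h N ↔ e ∈ singles h N := by
    have hS₁ : ∀ e, s (σ₁ e) = s e := by
      intro e
      by_cases h1 : σ₁ e = e
      · rw [h1]
      · have h2 := hns₁ e h1
        have h3 := hns₁ (σ₁ e) (by rw [hi₁]; exact Ne.symm h1)
        simp [s, h2, h3]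
    have hS₂ : ∀ e, s (σ₂ e) = s e := by
      intro e
      by_cases h1 : σ₂ e = σ₁ e
      · rw [h1, hS₁]
      · exact congrArg Prod.snd (hk₂ e h1).2
    intro e
    have hS₃ : s (σ₃ e) = s e := by
      by_cases h1 : σ₃ e = σ₂ e
      · rw [h1, hS₂]
      · exact (hk₃ e h1).2
    simpa [s] using hS₃
  refine ⟨σ₄, hi₄, fun ε hε₄ => ?_⟩
  have hε₃ : Alternates σ₃ ε := fun e he => by
    have h1 := he₄ e he
    rw [← h1] at he ⊢
    exact hε₄ e he
  have hε₂ : Alternates σ₂ ε := fun e he => by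
    have h1 := he₃ e he
    rw [← h1] at he ⊢
    exact hε₃ e he
  have hε₁ : Alternates σ₁ ε := fun e he => by
    have h1 := he₂ e he
    rw [← h1] at he ⊢
    exact hε₂ e he
  have hboth : ∀ {σ : A → A}, Alternates σ ε → ∀ e, σ e ≠ e → ∀ b, ε e = b ∨ ε (σ e) = b := by
    intro σ hσ e he b
    have := hσ e he
    revert this
    cases ε e <;> cases ε (σ e) <;> cases b <;> simp
  have hv : ∀ e ∈ N, e ∉ singles h N → ∀ b, ∃ e' ∈ N, ε e' = b ∧ h e' = h e := by
    intro e he hes b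
    obtain ⟨c, hcN, hce, hcm⟩ : ∃ c ∈ N, h c = h e ∧ σ₁ c ≠ c := by
      by_contra! hcon
      refine hes (mem_singles.2 ⟨he, fun e' he' hee => ?_⟩)
      exact hf₁ e' he' e he (hcon e' he' hee) (hcon e he rfl) hee
    rcases hboth hε₁ c hcm b with h1 | h1
    · exact ⟨c, hcN, h1, hce⟩
    · exact ⟨σ₁ c, hN hi₁ hs₁ c hcN, h1, (hk₁ c hcm).2.trans hce⟩
  refine ⟨fun K hK b => ?_, _, _, rfl, rfl, ?_⟩
  · by_cases hex : ∃ e ∈ N, h e ∈ K ∧ e ∉ singles h N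
    · obtain ⟨e, he, heK, hes⟩ := hex
      obtain ⟨e', h1, h2, h3⟩ := hv e he hes b
      exact ⟨e', h1, h2, h3 ▸ heK⟩
    -- All arcs into `K` are now singles with key `{K}`. There are at least two, so `σ₂` pairs one
    -- of them with another arc into `K`.
    · push Not at hex
      have hg : ∀ e, h e ∈ K → g e = {K} := by
        intro e he
        ext K'
        simp only [g, mem_filter, mem_singleton]
        constructor
        · rintro ⟨h1, h2⟩
          exact hdisj K' h1 K hK _ h2 he
        · rintro rfl
          exact ⟨hK, he⟩
      obtain ⟨c, hcN, hcK, hcm⟩ : ∃ c ∈ N, h c ∈ K ∧ σ₂ c ≠ c := by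
        obtain ⟨e, he, e', he', hne, heK, heK'⟩ := htwo K hK
        by_contra! hcon
        refine hne (hf₂ e he e' he' (hcon e he heK) (hcon e' he' heK') ?_)
        simp [hg e heK, hg e' heK', s, hex e he heK, hex e' he' heK']
      have h1 : σ₁ c = c := by
        by_contra h1
        exact hns₁ c h1 (hex c hcN hcK)
      have h2 : g (σ₂ c) = g c := congrArg Prod.fst (hk₂ c (by rwa [h1])).2
      have h3 : h (σ₂ c) ∈ K := by
        have : K ∈ g (σ₂ c) := by rw [h2, hg c hcK]; exact mem_singleton_self K
        exact (mem_filter.1 this).2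
      rcases hboth hε₂ c hcm b with h4 | h4
      · exact ⟨c, hcN, h4, hcK⟩
      · exact ⟨σ₂ c, hN hi₂ hs₂ c hcN, h4, h3⟩
  · rw [card_image_colour hv, card_image_colour hv]
    have hsub : singles h N ⊆ N := filter_subset _ _
    have e1 := hε₄.abs_card_sub_card_le_one hi₄ (hN hi₄ hs₄)
      (fun e he e' he' h1 h2 => hf₄ e he e' he' h1 h2 rfl)
    have e2 := hε₃.abs_card_sub_card_le_one hi₃ (T := singles h N) (fun e he => (hS e).2 he)
      (fun e he e' he' h1 h2 => hf₃ e (hsub he) e' (hsub he') h1 h2 (by simp [s, he, he']))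
    have e3 := hε₃.abs_card_sub_card_le_one hi₃ (T := N \ singles h N)
      (fun e he => by
        rw [mem_sdiff] at he ⊢
        exact ⟨hN hi₃ hs₃ e he.1, fun h1 => he.2 ((hS e).1 h1)⟩)
      (fun e he e' he' h1 h2 => by
        rw [mem_sdiff] at he he'
        exact hf₃ e he.1 e' he'.1 h1 h2 (by simp [s, he.2, he'.2]))
    have e4 : ∀ b, #{e ∈ N | ε e = b} =
        #{e ∈ singles h N | ε e = b} + #{e ∈ N \ singles h N | ε e = b} := by
      intro b
      rw [← card_union_of_disjoint (disjoint_filter_filter disjoint_sdiff), ← filter_union,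
        union_sdiff_of_subset hsub]
    have e5 := e4 true
    have e6 := e4 false
    rw [abs_le] at *
    refine ⟨?_, ?_, ?_⟩ <;> (try rw [abs_le]) <;> omega

end Pairing

/-! ### Completing a colouring on one side -/

section Side

variable {V A : Type*} [DecidableEq V] [DecidableEq A] [Fintype V] {t h : A → V}

/-- Given two disjoint arc sets through which `U` is reached from outside, some involution `σ` is
such that the arcs leading into `U` can be recoloured along any colouring alternating on `σ`. -/
theorem exists_side_pairing [Finite A] {F₁ F₂ N : Finset A} {U : Finset V}
    (hF : Disjoint F₁ F₂) (h₁ : EntersAvoiding t h F₁ Uᶜ) (h₂ : EntersAvoiding t h F₂ Uᶜ)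
    (hN : ∀ a, a ∈ N ↔ a ∈ F₁ ∪ F₂ ∧ t a ∉ U ∧ h a ∈ U) :
    ∃ σ : A → A, σ.Involutive ∧ ∀ ε, Alternates σ ε →
      ∃ S ⊆ {a ∈ F₁ ∪ F₂ | t a ∈ U ∧ h a ∈ U}, ∃ S' ⊆ {a ∈ F₁ ∪ F₂ | t a ∈ U ∧ h a ∈ U},
        Disjoint S S' ∧
        EntersAvoiding t h (S ∪ {e ∈ N | ε e = true}) Uᶜ ∧
        EntersAvoiding t h (S' ∪ {e ∈ N | ε e = false}) Uᶜ ∧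
        ∃ n x : ℤ, n = #{e ∈ N | ε e = true} - #{e ∈ N | ε e = false} ∧
          x = (#S : ℤ) - #S' ∧ |n| ≤ 1 ∧ |x| ≤ 1 ∧ |n + x| ≤ 1 := by
  set C : Finset A := {a ∈ F₁ ∪ F₂ | t a ∈ U ∧ h a ∈ U} with hC
  -- Sets entered by no inner arc can only be reached by crossing arcs. The minimal ones are
  -- disjoint by submodularity, and the two given sets enter each by distinct crossing arcs.
  let P : Finset V → Prop := fun X => X.Nonempty ∧ X ⊆ U ∧ inCut t h C X = ∅
  classical
  let 𝒦 : Finset (Finset V) := {K | Minimal P K}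
  have hent : ∀ X : Finset V, X.Nonempty → X ⊆ U → ∃ a ∈ F₁ ∪ F₂, ∃ a' ∈ F₁ ∪ F₂, a ≠ a' ∧
      (t a ∉ X ∧ h a ∈ X) ∧ (t a' ∉ X ∧ h a' ∈ X) := by
    intro X hX hXU
    have hd : Disjoint X Uᶜ := by rwa [← le_compl_iff_disjoint_right, compl_compl]
    obtain ⟨a, ha, ha'⟩ := h₁ X hX hd
    obtain ⟨c, hc, hc'⟩ := h₂ X hX hd
    exact ⟨a, mem_union_left _ ha, c, mem_union_right _ hc,
      fun hac => disjoint_left.1 hF ha (hac ▸ hc), ha', hc'⟩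
  have hsplit : ∀ X ⊆ U, ∀ a ∈ F₁ ∪ F₂, t a ∉ X → h a ∈ X → a ∈ N ∨ a ∈ inCut t h C X := by
    intro X hXU a ha h1 h2
    by_cases htU : t a ∈ U
    · exact Or.inr (mem_inCut.2 ⟨by simp only [hC, mem_filter]; exact ⟨ha, htU, hXU h2⟩, h1, h2⟩)
    · exact Or.inl ((hN a).2 ⟨ha, htU, hXU h2⟩)
  obtain ⟨σ, hσ, H⟩ := exists_pairing h N 𝒦 (by
      intro K hK K' hK' v hv hv'
      simp only [𝒦, mem_filter_univ] at hK hK'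
      have hP : P (K ∩ K') := by
        refine ⟨⟨v, mem_inter.2 ⟨hv, hv'⟩⟩, inter_subset_left.trans hK.1.2.1, ?_⟩
        have h1 := card_inCut_submodular (t := t) (h := h) C K K'
        rw [hK.1.2.2, hK'.1.2.2, card_empty] at h1
        exact card_eq_zero.1 (by omega)
      have h1 : K ≤ K ∩ K' := hK.2 hP inter_subset_left
      have h2 : K' ≤ K ∩ K' := hK'.2 hP inter_subset_right
      exact le_antisymm (h1.trans inter_subset_right) (h2.trans inter_subset_left)) (by
      intro K hK
      simp only [𝒦, mem_filter_univ] at hK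
      obtain ⟨hK1, hK2, hK3⟩ := hK.1
      obtain ⟨a, ha, c, hc, hne, ha', hc'⟩ := hent K hK1 hK2
      have h1 := hsplit K hK2 a ha ha'.1 ha'.2
      have h2 := hsplit K hK2 c hc hc'.1 hc'.2
      simp only [hK3, notMem_empty, or_false] at h1 h2
      exact ⟨a, h1, c, h2, hne, ha'.2, hc'.2⟩)
  refine ⟨σ, hσ, fun ε hε => ?_⟩
  obtain ⟨hK, n, ρ, hn, hρ, hn1, hρ1, hnρ⟩ := H ε hε
  let Q : Bool → Finset V := fun b => {e ∈ N | ε e = b}.image h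
  have hQ : ∀ b v, v ∈ Q b ↔ ∃ e ∈ N, ε e = b ∧ h e = v := by
    intro b v; simp [Q, and_assoc]
  have hQU : ∀ b, Q b ⊆ U := by
    intro b v hv
    obtain ⟨e, he, -, rfl⟩ := (hQ b v).1 hv
    exact ((hN e).1 he).2.2
  obtain ⟨S, hS, S', hS', hSS, hSE, hSE', hSc, hSc'⟩ :=
    exists_disjoint_branchings (t := t) (h := h) (C := C) (R := Q true ∪ Uᶜ)
      (R' := Q false ∪ Uᶜ) (by
    intro X hX
    simp only [disjoint_union_right]
    by_cases hXU : Disjoint X Uᶜ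
    swap
    · simp [hXU]
    have hXU' : X ⊆ U := by rwa [← le_compl_iff_disjoint_right, compl_compl] at hXU
    simp only [hXU, and_true]
    -- If no crossing arc leads into `X`, the two original sets enter it by distinct inner arcs.
    -- Otherwise the demand is at most one, and it is zero when no inner arc enters `X`, because `X`
    -- then contains a member of `𝒦`.
    by_cases hall : ∀ b, Disjoint X (Q b)
    · rw [if_pos (hall _), if_pos (hall _)]
      have hnot : ∀ a ∈ N, h a ∉ X := fun a ha hX =>
        disjoint_left.1 (hall (ε a)) hX ((hQ _ _).2 ⟨a, ha, rfl, rfl⟩)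
      obtain ⟨a, ha, c, hc, hne, ha', hc'⟩ := hent X hX hXU'
      have h1 := (hsplit X hXU' a ha ha'.1 ha'.2).resolve_left (fun h => hnot a h ha'.2)
      have h2 := (hsplit X hXU' c hc hc'.1 hc'.2).resolve_left (fun h => hnot c h hc'.2)
      exact one_lt_card.2 ⟨a, h1, c, h2, hne⟩
    · have hle : (if Disjoint X (Q true) then 1 else 0) + (if Disjoint X (Q false) then 1 else 0)
          ≤ 1 := by
        simp only [Bool.forall_bool, not_and_or] at hall
        rcases hall with h1 | h1 <;> simp only [h1, if_false] <;> split_ifs <;> simp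
      by_cases h0 : inCut t h C X = ∅
      · obtain ⟨K, hKX, hKm⟩ := exists_minimal_le_of_wellFoundedLT P X ⟨hX, hXU', h0⟩
        have hnd : ∀ b, ¬ Disjoint X (Q b) := by
          intro b hd
          obtain ⟨e, he, heb, heK⟩ := hK K (by simpa [𝒦] using hKm) b
          exact disjoint_left.1 hd (hKX heK) ((hQ _ _).2 ⟨e, he, heb, rfl⟩)
        simp [hnd]
      · exact hle.trans (card_pos.2 (nonempty_iff_ne_empty.2 h0)))
  have hcard : ∀ b, #(Q b ∪ Uᶜ)ᶜ + #(Q b) = #U := by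
    intro b
    have : (Q b ∪ Uᶜ)ᶜ = U \ Q b := by
      ext v; simp only [mem_compl, mem_union, mem_sdiff, not_or, not_not]; tauto
    rw [this, card_sdiff_add_card_eq_card (hQU b)]
  have henter : ∀ b S, EntersAvoiding t h S (Q b ∪ Uᶜ) →
      EntersAvoiding t h (S ∪ {e ∈ N | ε e = b}) Uᶜ := by
    intro b S hS X hX hXU
    by_cases hd : Disjoint X (Q b)
    · obtain ⟨a, ha, ha'⟩ := hS X hX (disjoint_union_right.2 ⟨hd, hXU⟩)
      exact ⟨a, mem_union_left _ ha, ha'⟩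
    · obtain ⟨v, hvX, hv⟩ := not_disjoint_iff.1 hd
      obtain ⟨e, he, heb, rfl⟩ := (hQ b v).1 hv
      refine ⟨e, mem_union_right _ (mem_filter.2 ⟨he, heb⟩), fun h1 => ?_, hvX⟩
      have := disjoint_left.1 hXU h1
      rw [mem_compl, not_not] at this
      exact ((hN e).1 he).2.1 this
  refine ⟨S, hS, S', hS', hSS, henter _ _ hSE, henter _ _ hSE', n, (#S : ℤ) - #S', hn, rfl, hn1, ?_⟩
  -- Each completion has one arc per vertex of `U` outside its heads, so an excess of heads is an
  -- equal deficit of arcs.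
  have hx : (#S : ℤ) - #S' = - ρ := by
    have h1 := hcard true
    have h2 := hcard false
    rw [hρ]
    simp only [Q] at *
    omega
  rw [hx, abs_neg]
  exact ⟨hρ1, by rwa [← sub_eq_add_neg]⟩

end Side

/-! ### Rebalancing two bibranchings -/

/-- Take `m` as close to `b / 2` as `[p, q]` allows. At an endpoint, `2 * m - b` lies between `0`
and `x + y`, and `|n + y| ≤ 1` with `|x| ≤ 1` bounds the total. In the interior, `b / 2` is rounded
against the sign of `n`. -/
theorem exists_balanced_size {n x y : ℤ} {p q b : ℕ} (hpq : p ≤ q)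
    (hxy : (p : ℤ) + q = b + (x + y)) (hn : |n| ≤ 1) (hx : |x| ≤ 1) (hy : |y| ≤ 1) (hny : |n + y| ≤ 1) :
    ∃ m : ℕ, p ≤ m ∧ m ≤ q ∧ |(m : ℤ) - (b - m)| ≤ 2 ∧ |n + ((m : ℤ) - (b - m))| ≤ 2 := by
  simp only [abs_le] at hn hx hy hny ⊢
  by_cases hlow : b ≤ 2 * p
  · exact ⟨p, le_rfl, hpq, by omega, by omega⟩
  by_cases hhigh : 2 * q ≤ b
  · exact ⟨q, hpq, le_rfl, by omega, by omega⟩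
  by_cases h0 : n ≤ 0
  · exact ⟨(b + 1) / 2, by omega, by omega, by omega, by omega⟩
  · exact ⟨b / 2, by omega, by omega, by omega, by omega⟩

section Rebalancing

variable {V A : Type*} [DecidableEq V] [DecidableEq A] [Fintype V] [Finite A]

/-- `F` is a bibranching, in terms of cuts: every nonempty subset of `U` is left by an arc of `F`
and every nonempty subset of `Uᶜ` is entered by one. -/
def CutBibranching (t h : A → V) (U : Finset V) (F : Finset A) : Prop :=
  EntersAvoiding t h F U ∧ EntersAvoiding h t F Uᶜ

theorem exists_rebalanced_pair {t h : A → V} {U : Finset V} {F₁ F₂ : Finset A}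
    (hF : Disjoint F₁ F₂)
    (h₁ : CutBibranching t h U F₁) (h₂ : CutBibranching t h U F₂)
    (N : Finset A) (hN : ∀ a, a ∈ N ↔ t a ∈ U ∧ h a ∉ U) :
    ∃ G₁ G₂ : Finset A, Disjoint G₁ G₂ ∧ G₁ ∪ G₂ = F₁ ∪ F₂ ∧
      CutBibranching t h U G₁ ∧ CutBibranching t h U G₂ ∧
      |(#G₁ : ℤ) - #G₂| ≤ 2 ∧ |(#(G₁ ∩ N) : ℤ) - #(G₂ ∩ N)| ≤ 1 ∧
      |(#(G₁ \ N) : ℤ) - #(G₂ \ N)| ≤ 2 := by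
  set M := (F₁ ∪ F₂) ∩ N with hM
  have hMmem : ∀ a, a ∈ M ↔ a ∈ F₁ ∪ F₂ ∧ t a ∈ U ∧ h a ∉ U := by
    intro a; rw [hM, mem_inter, hN]
  obtain ⟨σ, hσ, Hσ⟩ := exists_side_pairing (t := t) (h := h) (N := M) (U := Uᶜ) hF
    (by rw [compl_compl]; exact h₁.1) (by rw [compl_compl]; exact h₂.1)
    (by intro a; simp [hMmem])
  obtain ⟨τ, hτ, Hτ⟩ := exists_side_pairing (t := h) (h := t) (N := M) (U := U) hF h₁.2 h₂.2
    (by intro a; rw [hMmem]; tauto)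
  obtain ⟨ε, hεσ, hετ⟩ := exists_common_alternates hσ hτ
  obtain ⟨S, hS, S', hS', hSS, hSE, hSE', n, x, hn, hx, hn1, hx1, hnx⟩ := Hσ ε hεσ
  obtain ⟨T, hT, T', hT', hTT, hTE, hTE', n', y, hn', hy, -, hy1, hny⟩ := Hτ ε hετ
  rw [compl_compl] at hSE hSE'
  set B := (F₁ ∪ F₂) \ N with hB
  have hBS : ∀ {S : Finset A}, S ⊆ {a ∈ F₁ ∪ F₂ | t a ∈ Uᶜ ∧ h a ∈ Uᶜ} → S ⊆ B := by
    intro S hS a ha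
    have := hS ha
    simp only [mem_filter, mem_compl] at this
    rw [hB, mem_sdiff, hN]
    tauto
  have hBT : ∀ {S : Finset A}, S ⊆ {a ∈ F₁ ∪ F₂ | h a ∈ U ∧ t a ∈ U} → S ⊆ B := by
    intro S hS a ha
    have := hS ha
    simp only [mem_filter] at this
    rw [hB, mem_sdiff, hN]
    tauto
  have hcross : ∀ {S T : Finset A}, S ⊆ {a ∈ F₁ ∪ F₂ | t a ∈ Uᶜ ∧ h a ∈ Uᶜ} →
      T ⊆ {a ∈ F₁ ∪ F₂ | h a ∈ U ∧ t a ∈ U} → Disjoint S T := by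
    intro S T hS hT
    rw [disjoint_left]
    intro a ha ha'
    have h1 := hS ha
    have h2 := hT ha'
    simp only [mem_filter, mem_compl] at h1 h2
    tauto
  have hdis : Disjoint (S ∪ T) (S' ∪ T') := by
    simp only [disjoint_union_left, disjoint_union_right]
    exact ⟨⟨hSS, (hcross hS' hT).symm⟩, hcross hS hT', hTT⟩
  have hc1 : #(S ∪ T) = #S + #T := card_union_of_disjoint (hcross hS hT)
  have hc2 : #(S' ∪ T') = #S' + #T' := card_union_of_disjoint (hcross hS' hT')
  have hsub1 : S ∪ T ⊆ B := union_subset (hBS hS) (hBT hT)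
  have hsub2 : S' ∪ T' ⊆ B := union_subset (hBS hS') (hBT hT')
  have hsub3 : S ∪ T ⊆ B \ (S' ∪ T') := subset_sdiff.2 ⟨hsub1, hdis⟩
  have hle := card_le_card hsub3
  have hc3 := card_sdiff_add_card_eq_card hsub2
  obtain ⟨m, hm1, hm2, hm3, hm4⟩ : ∃ m, #(S ∪ T) ≤ m ∧ m ≤ #(B \ (S' ∪ T')) ∧
      |(m : ℤ) - (#B - m)| ≤ 2 ∧ |n + ((m : ℤ) - (#B - m))| ≤ 2 := by
    refine exists_balanced_size (x := x) (y := y) hle ?_ hn1 hx1 hy1 (by rwa [hn, ← hn'])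
    rw [hc1, hx, hy]
    omega
  -- `W` contains the completions `S`, `T` of the first colour and leaves `S'`, `T'` to the second;
  -- any size in between is available.
  obtain ⟨W, hW1, hW2, hW3⟩ := exists_subsuperset_card_eq hsub3 hm1 hm2
  have hWB : W ⊆ B := hW2.trans sdiff_subset
  have hMN : ∀ b, {e ∈ M | ε e = b} ⊆ N := fun b => (filter_subset _ _).trans inter_subset_right
  have hBN : ∀ {X}, X ⊆ B → Disjoint X N := fun hX => disjoint_of_subset_left hX sdiff_disjoint
  have hBW : B \ W ⊆ B := sdiff_subset
  have hinter : ∀ {X : Finset A} (b : Bool), X ⊆ B →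
      (X ∪ {e ∈ M | ε e = b}) ∩ N = {e ∈ M | ε e = b} := by
    intro X b hX
    rw [union_inter_distrib_right, disjoint_iff_inter_eq_empty.1 (hBN hX), empty_union,
      inter_eq_left.2 (hMN b)]
  have hsdiff : ∀ {X : Finset A} (b : Bool), X ⊆ B →
      (X ∪ {e ∈ M | ε e = b}) \ N = X := by
    intro X b hX
    rw [union_sdiff_distrib, sdiff_eq_self_of_disjoint (hBN hX),
      sdiff_eq_empty_iff_subset.2 (hMN b), union_empty]
  have hcard : ∀ {X : Finset A} (b : Bool), X ⊆ B →
      #(X ∪ {e ∈ M | ε e = b}) = #X + #{e ∈ M | ε e = b} := fun b hX =>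
    card_union_of_disjoint (disjoint_of_subset_right (hMN b) (hBN hX))
  have hcW := card_sdiff_add_card_eq_card hWB
  have hS'W : S' ∪ T' ⊆ B \ W :=
    subset_sdiff.2 ⟨hsub2, disjoint_of_subset_right hW2 disjoint_sdiff⟩
  refine ⟨W ∪ {e ∈ M | ε e = true}, (B \ W) ∪ {e ∈ M | ε e = false}, ?_, ?_, ⟨?_, ?_⟩, ⟨?_, ?_⟩,
    ?_, ?_, ?_⟩
  · simp only [disjoint_union_left, disjoint_union_right]
    refine ⟨⟨disjoint_sdiff, ?_⟩, ?_, ?_⟩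
    · exact (disjoint_of_subset_right (hMN _) (hBN hBW)).symm
    · exact disjoint_of_subset_right (hMN _) (hBN hWB)
    · rw [disjoint_filter]
      intro e _ h1 h2
      rw [h1] at h2
      exact absurd h2 (by simp)
  · have e1 : {e ∈ M | ε e = true} ∪ {e ∈ M | ε e = false} = M := by
      ext a
      simp only [mem_union, mem_filter]
      cases ε a <;> simp
    rw [union_union_union_comm, union_sdiff_of_subset hWB, e1, hB, hM, sdiff_union_inter]
  · exact hSE.mono (union_subset_union_left (subset_union_left.trans hW1))
  · exact hTE.mono (union_subset_union_left (subset_union_right.trans hW1))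
  · exact hSE'.mono (union_subset_union_left (subset_union_left.trans hS'W))
  · exact hTE'.mono (union_subset_union_left (subset_union_right.trans hS'W))
  · have e1 : ((#(B \ W) : ℕ) : ℤ) = #B - m := by omega
    rw [hcard _ hWB, hcard _ hBW]
    push_cast
    rw [hn] at hm4
    rw [e1, hW3, show ∀ a b c d : ℤ, a + b - (c + d) = b - d + (a - c) by intros; ring]
    exact hm4
  · rw [hinter _ hWB, hinter _ hBW, ← hn]
    exact hn1
  · have e1 : ((#(B \ W) : ℕ) : ℤ) = #B - m := by omega
    rw [hsdiff _ hWB, hsdiff _ hBW, e1, hW3]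
    exact hm3

end Rebalancing

/-! ### Paths and cuts -/

/-- A path from `R` into `X` must enter `X`; conversely, no arc enters the set of vertices
unreachable from `R`. -/
theorem MultiDigraph.forall_exists_reaches_iff {V A : Type*} [DecidableEq V] [Fintype V]
    (t h : A → V) (F : Finset A) (R : Finset V) :
    (∀ v ∉ R, ∃ u ∈ R, Relation.ReflTransGen (fun x y => ∃ a ∈ F, t a = x ∧ h a = y) u v) ↔
      EntersAvoiding t h F R := by
  classical
  constructor
  · intro H X ⟨x, hx⟩ hXR
    obtain ⟨u, hu, hux⟩ := H x (disjoint_left.1 hXR hx)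
    induction hux with
    | refl => exact absurd hu (disjoint_left.1 hXR hx)
    | @tail b c _ hbc ih =>
      obtain ⟨a, ha, rfl, rfl⟩ := hbc
      by_cases hb : t a ∈ X
      · exact ih hb
      · exact ⟨a, ha, hb, hx⟩
  · intro H v hv
    by_contra hcon
    push Not at hcon
    obtain ⟨a, ha, h1, h2⟩ := H
      {w | ∀ u ∈ R, ¬ Relation.ReflTransGen (fun x y => ∃ a ∈ F, t a = x ∧ h a = y) u w}
      ⟨v, by simpa using hcon⟩ (by
        rw [disjoint_left]
        intro w hw hwR
        simp only [mem_filter_univ] at hw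
        exact hw w hwR .refl)
    simp only [mem_filter_univ, not_forall, not_not] at h1 h2
    obtain ⟨u, hu, hut⟩ := h1
    exact h2 u hu (hut.tail ⟨a, ha, rfl, rfl⟩)

theorem MultiDigraph.isBibranching_iff {V A : Type*} [DecidableEq V] [Fintype V]
    (D : MultiDigraph V A) (U : Finset V) (F : Finset A) :
    D.IsBibranching (U : Set V) (Uᶜ : Set V) (F : Set A) ↔
      CutBibranching D.tail D.head U F := by
  rw [CutBibranching, ← forall_exists_reaches_iff, ← forall_exists_reaches_iff]
  have hswap : ∀ v w, D.Reaches (F : Set A) v w ↔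
      Relation.ReflTransGen (fun x y => ∃ a ∈ F, D.head a = x ∧ D.tail a = y) w v := by
    intro v w
    rw [← Relation.reflTransGen_swap, Reaches]
    simp only [mem_coe, and_comm]
  constructor
  · rintro ⟨h1, h2⟩
    refine ⟨fun v hv => h2 v hv, fun v hv => ?_⟩
    obtain ⟨w, hw, h3⟩ := h1 v (by simpa using hv)
    exact ⟨w, by simpa using hw, (hswap v w).1 h3⟩
  · rintro ⟨h1, h2⟩
    refine ⟨fun v hv => ?_, fun v hv => h1 v hv⟩
    obtain ⟨w, hw, h3⟩ := h2 v (by simpa using hv)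
    exact ⟨w, by simpa using hw, (hswap v w).2 h3⟩

/-! ### From pairs to the whole partition -/

/-- For a fixed sum, `2 * (x ^ 2 + y ^ 2) = (x + y) ^ 2 + (x - y) ^ 2` depends only on the
difference. -/
theorem le_of_sum_sq_exchange {x y p q u v : ℕ} (hs : u + (p ^ 2 + q ^ 2) = v + (x ^ 2 + y ^ 2))
    (hxy : x + y = p + q) : (|(x : ℤ) - y| ≤ |(p : ℤ) - q| → u ≤ v) ∧
      (|(x : ℤ) - y| < |(p : ℤ) - q| → u < v) := by
  have hs' : (u : ℤ) + (p ^ 2 + q ^ 2) = v + (x ^ 2 + y ^ 2) := by exact_mod_cast hs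
  have hxy' : (x : ℤ) + y = p + q := by exact_mod_cast hxy
  have key : 2 * ((u : ℤ) - v) = (x - y : ℤ) ^ 2 - (p - q : ℤ) ^ 2 := by
    have h4 : ((x : ℤ) + y) ^ 2 = (p + q) ^ 2 := by rw [hxy']
    linarith [h4]
  constructor
  · intro h
    have := sq_le_sq.2 h
    omega
  · intro h
    have := sq_lt_sq.2 h
    omega

theorem exists_pairwise_rebalanced {A : Type*} [Fintype A] [DecidableEq A] {k : ℕ} (N : Finset A)
    (P : Finset A → Prop)
    (hP : ∀ F₁ F₂, P F₁ → P F₂ → Disjoint F₁ F₂ → ∃ G₁ G₂ : Finset A, Disjoint G₁ G₂ ∧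
      G₁ ∪ G₂ = F₁ ∪ F₂ ∧ P G₁ ∧ P G₂ ∧
      |(#G₁ : ℤ) - #G₂| ≤ 2 ∧ |(#(G₁ ∩ N) : ℤ) - #(G₂ ∩ N)| ≤ 1 ∧
      |(#(G₁ \ N) : ℤ) - #(G₂ \ N)| ≤ 2)
    (F : Fin k → Finset A) (hF : ∀ i, P (F i)) (hd : ∀ i j, i ≠ j → Disjoint (F i) (F j))
    (hu : ∀ a, ∃ i, a ∈ F i) :
    ∃ G : Fin k → Finset A, (∀ i, P (G i)) ∧ (∀ i j, i ≠ j → Disjoint (G i) (G j)) ∧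
      (∀ a, ∃ i, a ∈ G i) ∧ ∀ i j, |(#(G i) : ℤ) - #(G j)| ≤ 2 ∧
        |(#(G i ∩ N) : ℤ) - #(G j ∩ N)| ≤ 1 ∧ |(#(G i \ N) : ℤ) - #(G j \ N)| ≤ 2 := by
  let Q : (Fin k → Finset A) → Prop := fun G =>
    (∀ i, P (G i)) ∧ (∀ i j, i ≠ j → Disjoint (G i) (G j)) ∧ ∀ a, ∃ i, a ∈ G i
  let Φ : (Fin k → Finset A) → ℕ ×ₗ ℕ ×ₗ ℕ := fun G =>
    toLex (∑ i, #(G i ∩ N) ^ 2, toLex (∑ i, #(G i \ N) ^ 2, ∑ i, #(G i) ^ 2))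
  obtain ⟨G, ⟨hG1, hG2, hG3⟩, hmin⟩ :=
    (InvImage.wf Φ wellFounded_lt).has_min {G | Q G} ⟨F, hF, hd, hu⟩
  refine ⟨G, hG1, hG2, hG3, fun i j => ?_⟩
  by_cases hij : i = j
  · subst hij; simp
  obtain ⟨X, Y, hXY, hun, hPX, hPY, h1, h2, h3⟩ := hP _ _ (hG1 i) (hG1 j) (hG2 i j hij)
  let G' : Fin k → Finset A := Function.update (Function.update G i X) j Y
  have hi : G' i = X := by simp [G', hij]
  have hj : G' j = Y := by simp [G']
  have ho : ∀ l, l ≠ i → l ≠ j → G' l = G l := fun l h1 h2 => by simp [G', h1, h2]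
  have hmem : ∀ a, a ∈ X ∨ a ∈ Y ↔ a ∈ G i ∨ a ∈ G j := fun a => by
    rw [← mem_union, hun, mem_union]
  have hXo : ∀ l, l ≠ i → l ≠ j → Disjoint X (G l) ∧ Disjoint Y (G l) := by
    intro l hli hlj
    rw [← disjoint_union_left, hun, disjoint_union_left]
    exact ⟨hG2 _ _ hli.symm, hG2 _ _ hlj.symm⟩
  have hQ : Q G' := by
    refine ⟨fun l => ?_, fun l m hlm => ?_, fun a => ?_⟩
    · by_cases hli : l = i
      · rw [hli, hi]; exact hPX
      by_cases hlj : l = j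
      · rw [hlj, hj]; exact hPY
      rw [ho l hli hlj]; exact hG1 l
    · wlog hml : l = i ∨ (l = j ∧ m ≠ i) ∨ (l ≠ i ∧ l ≠ j ∧ m ≠ i ∧ m ≠ j) generalizing l m
      · exact (this m l hlm.symm (by grind)).symm
      rcases hml with rfl | ⟨rfl, hmi⟩ | ⟨a1, a2, a3, a4⟩
      · by_cases hmj : m = j
        · rw [hmj, hi, hj]; exact hXY
        · rw [hi, ho m hlm.symm hmj]; exact (hXo m hlm.symm hmj).1
      · rw [hj, ho m hmi hlm.symm]; exact (hXo m hmi hlm.symm).2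
      · rw [ho l a1 a2, ho m a3 a4]; exact hG2 l m hlm
    · obtain ⟨l, hl⟩ := hG3 a
      by_cases hl' : l = i ∨ l = j
      · have : a ∈ X ∨ a ∈ Y := (hmem a).2 (by rcases hl' with rfl | rfl <;> simp [hl])
        rcases this with h | h
        · exact ⟨i, hi ▸ h⟩
        · exact ⟨j, hj ▸ h⟩
      · push Not at hl'
        exact ⟨l, by rw [ho l hl'.1 hl'.2]; exact hl⟩
  have hsum : ∀ φ : Finset A → ℕ, ∑ l, φ (G' l) + (φ (G i) + φ (G j)) =
      ∑ l, φ (G l) + (φ X + φ Y) := by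
    intro φ
    have hs : ∀ H : Fin k → Finset A, ∑ l, φ (H l) =
        φ (H i) + (φ (H j) + ∑ l ∈ (univ.erase i).erase j, φ (H l)) := by
      intro H
      rw [add_sum_erase _ (fun l => φ (H l)) (mem_erase.2 ⟨Ne.symm hij, mem_univ j⟩),
        add_sum_erase _ (fun l => φ (H l)) (mem_univ i)]
    have hr : ∑ l ∈ (univ.erase i).erase j, φ (G' l) = ∑ l ∈ (univ.erase i).erase j, φ (G l) :=
      sum_congr rfl fun l hl => by
        simp only [mem_erase] at hl
        rw [ho l hl.2.1 hl.1]
    rw [hs G, hs G', hr, hi, hj]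
    ring
  have hnlt : ¬ Φ G' < Φ G := hmin G' hQ
  simp only [Φ, Prod.Lex.toLex_lt_toLex] at hnlt
  have s1 := hsum (fun S => #(S ∩ N) ^ 2)
  have s2 := hsum (fun S => #(S \ N) ^ 2)
  have s3 := hsum (fun S => #S ^ 2)
  have hcN : #(X ∩ N) + #(Y ∩ N) = #(G i ∩ N) + #(G j ∩ N) := by
    rw [← card_union_of_disjoint, ← card_union_of_disjoint, ← union_inter_distrib_right,
      ← union_inter_distrib_right, hun]
    · exact disjoint_of_subset_left inter_subset_left
        (disjoint_of_subset_right inter_subset_left (hG2 i j hij))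
    · exact disjoint_of_subset_left inter_subset_left
        (disjoint_of_subset_right inter_subset_left hXY)
  have hcF : #X + #Y = #(G i) + #(G j) := by
    rw [← card_union_of_disjoint hXY, hun, card_union_of_disjoint (hG2 i j hij)]
  have hsp : ∀ S : Finset A, #S = #(S \ N) + #(S ∩ N) := fun S =>
    (card_sdiff_add_card_inter S N).symm
  have hsX := hsp X
  have hsY := hsp Y
  have hsi := hsp (G i)
  have hsj := hsp (G j)
  generalize ∑ l, #(G' l ∩ N) ^ 2 = a1 at *
  generalize ∑ l, #(G l ∩ N) ^ 2 = a2 at *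
  generalize ∑ l, #(G' l \ N) ^ 2 = b1 at *
  generalize ∑ l, #(G l \ N) ^ 2 = b2 at *
  generalize ∑ l, #(G' l) ^ 2 = c1 at *
  generalize ∑ l, #(G l) ^ 2 = c2 at *
  clear hmin hsum hQ hXo hmem ho hi hj hsp hun hXY
  have t1 := le_of_sum_sq_exchange s1 hcN
  have t2 := le_of_sum_sq_exchange s2 (by omega)
  have t3 := le_of_sum_sq_exchange s3 hcF
  have n1 : |(#(G i ∩ N) : ℤ) - #(G j ∩ N)| ≤ 1 := by
    by_contra! hc
    exact hnlt (Or.inl (t1.2 (h2.trans_lt hc)))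
  -- Both differences have the same parity since the sums agree, so a new difference of at most one
  -- cannot exceed the old one.
  have n2 : a1 ≤ a2 := t1.1 (by
    rcases abs_cases ((#(X ∩ N) : ℤ) - #(Y ∩ N)) with h | h <;>
    rcases abs_cases ((#(G i ∩ N) : ℤ) - #(G j ∩ N)) with h' | h' <;> omega)
  have n3 : |(#(G i \ N) : ℤ) - #(G j \ N)| ≤ 2 := by
    by_contra! hc
    have := t2.2 (h3.trans_lt hc)
    exact hnlt (by omega)
  refine ⟨?_, n1, n3⟩
  by_contra! hc
  -- A total difference above two forces differences one in `N` and two outside `N`. By parity the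
  -- new difference outside `N` is zero or two, so only the third coordinate of `Φ` changes strictly
  -- upon exchange, unless an earlier one already drops.
  have n4 : b1 ≤ b2 := t2.1 (by
    rw [abs_le] at h1 h2 h3 n1 n3
    rcases abs_cases ((#(X \ N) : ℤ) - #(Y \ N)) with h | h <;>
    rcases abs_cases ((#(G i \ N) : ℤ) - #(G j \ N)) with h' | h' <;>
    rcases abs_cases ((#(G i) : ℤ) - #(G j)) with h'' | h'' <;> omega)
  have := t3.2 (h1.trans_lt hc)
  exact hnlt (by omega)

theorem mainTheorem11 {V A : Type*} [Finite V] [Finite A] (D : MultiDigraph V A)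
    (V₁ V₂ : Set V) (hD : D.IsPartitionable V₁ V₂) (k : ℕ)
    (h : ∃ F : Fin k → Set A, D.IsBibranchingPartition V₁ V₂ F) :
    ∃ F : Fin k → Set A, D.IsBibranchingPartition V₁ V₂ F ∧
      ∀ i j : Fin k,
        |((F i).ncard : ℤ) - ((F j).ncard : ℤ)| ≤ 2 ∧
        |((F i ∩ D.delta V₁ V₂).ncard : ℤ) - ((F j ∩ D.delta V₁ V₂).ncard : ℤ)| ≤ 1 ∧
        |((F i \ D.delta V₁ V₂).ncard : ℤ) - ((F j \ D.delta V₁ V₂).ncard : ℤ)| ≤ 2 := by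
  classical
  have := Fintype.ofFinite V
  have := Fintype.ofFinite A
  obtain ⟨F, hF⟩ := h
  obtain ⟨U, rfl⟩ : ∃ U : Finset V, V₁ = U := ⟨V₁.toFinset, by simp⟩
  obtain rfl : V₂ = (U : Set V)ᶜ :=
    (IsCompl.compl_eq ⟨hD.disjoint, codisjoint_iff.2 hD.union_eq⟩).symm
  obtain ⟨N, hN⟩ : ∃ N : Finset A, D.delta (U : Set V) (U : Set V)ᶜ = N :=
    ⟨(D.delta (U : Set V) (U : Set V)ᶜ).toFinset, by simp⟩
  have hNmem : ∀ a, a ∈ N ↔ D.tail a ∈ U ∧ D.head a ∉ U := by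
    intro a
    rw [← mem_coe, ← hN]
    simp [MultiDigraph.delta]
  obtain ⟨F', rfl⟩ : ∃ F' : Fin k → Finset A, F = fun i => (F' i : Set A) :=
    ⟨fun i => (F i).toFinset, by simp⟩
  obtain ⟨G, hG1, hG2, hG3, hG4⟩ := exists_pairwise_rebalanced N
    (CutBibranching D.tail D.head U)
    (fun F₁ F₂ h₁ h₂ hd => exists_rebalanced_pair hd h₁ h₂ N hNmem) F'
    (fun i => (D.isBibranching_iff U _).1 (hF.bibranching i))
    (fun i j hij => disjoint_coe.1 (hF.disjoint i j hij))
    (fun a => by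
      have : a ∈ ⋃ i, (F' i : Set A) := hF.union_eq ▸ Set.mem_univ a
      simpa using this)
  refine ⟨fun i => (G i : Set A), ⟨fun i => (D.isBibranching_iff U _).2 (hG1 i),
    fun i j hij => disjoint_coe.2 (hG2 i j hij), ?_⟩, fun i j => ?_⟩
  · ext a
    simpa using hG3 a
  · simp only [hN, ← coe_inter, ← coe_sdiff, Set.ncard_coe_finset]
    exact hG4 i j
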